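/- Let $\mathcal S$ and $\mathcal A$ be finite sets, $\mathcal A\neq\emptyset$, and consider a Markov decision process with transition probabilities $\mathcal T(s,a,s')$ and reward vectors $\mathbf r(s,a,s')=(r_0,\dots,r_k)\in\mathbb R^{k+1}$ (automatically bounded). Let $f:\mathbb R^{k+1}\to[0,1]$ be a reward-dependent discount function with $f\le\gamma'$ for some constant $\gamma'<1$. Put $$(\mathcal H Q)(s,a)=\sum_{s'\in\mathcal S}\mathcal T(s,a,s')\Big[\sum_{i=0}^k r_i(s,a,s')+f(\mathbf r(s,a,s'))\max_{a'}Q(s',a')\Big].$$ The optimal Q-function $Q^*$ is the solution of the Bellman equation $Q=\mathcal H Q$. On a probability space with a filtration $(\mathcal F_t)_{t\ge0}$, consider 1-step multi-discount Q-learning: $Q_0$ is an arbitrary $\mathcal F_0$-measurable table; at each time $t$ the visited pair $(s_t,a_t)$ and the learning rates $\alpha_t(s,a)\in[0,1]$ are $\mathcal F_t$-measurable; the observed successor state $s'_t$ is $\mathcal F_{t+1}$-measurable with $\Pr(s'_t=y\mid\mathcal F_t)=\mathcal T(s_t,a_t,y)$ for all $y\in\mathcal S$ (it is allowed, but not required,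 that $s_{t+1}=s'_t$); and, with $\mathbf r_t=\mathbf r(s_t,a_t,s'_t)$, $$Q_{t+1}(s_t,a_t)=Q_t(s_t,a_t)+\alpha_t(s_t,a_t)\Big[\sum_{i=0}^k r_{i,t}+f(\mathbf r_t)\max_{a'}Q_t(s'_t,a')-Q_t(s_t,a_t)\Big],$$ while $Q_{t+1}(s,a)=Q_t(s,a)$ for all $(s,a)\ne(s_t,a_t)$. Suppose that for every $(s,a)\in\mathcal S\times\mathcal A$, with probability 1, $$\sum_{t:\,(s_t,a_t)=(s,a)}\alpha_t(s,a)=\infty\qquad\text{and}\qquad\sum_{t:\,(s_t,a_t)=(s,a)}\alpha_t(s,a)^2<\infty .$$ Then the Bellman equation $Q=\mathcal H Q$ has exactly one solution $Q^*$, and with probability 1, $Q_t(s,a)\to Q^*(s,a)$ as $t\to\infty$ for all $(s,a)\in\mathcal S\times\mathcal A$. -/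

import Mathlib

open MeasureTheory Filter Topology

/-- A Markov decision process with state space `S`, action space `A` and vector-valued rewards
with components `r₀, …, r_k`: the transition `s → s'` under the action `a` has probability
`trans s a s'` and gives the reward vector `reward s a s'`. -/
structure MultiRewardMDP (S A : Type*) [Fintype S] (k : ℕ) where
  trans : S → A → S → ℝ
  reward : S → A → S → (Fin (k + 1) → ℝ)
  trans_nonneg : ∀ s a s', 0 ≤ trans s a s'
  trans_sum : ∀ s a, ∑ s', trans s a s' = 1

namespace MultiRewardMDP

variable {S A : Type*} [Fintype S] [Fintype A] [Nonempty A] {k : ℕ}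

/-- The sampled 1-step target `∑ᵢ rᵢ + f(r) max_{a'} Q(s', a')`, where `r` is the reward vector
of the transition from `s` to `s'` under `a`. -/
noncomputable def target (M : MultiRewardMDP S A k) (f : (Fin (k + 1) → ℝ) → ℝ)
    (Q : S → A → ℝ) (s : S) (a : A) (s' : S) : ℝ :=
  (∑ i, M.reward s a s' i) +
    f (M.reward s a s') * Finset.univ.sup' Finset.univ_nonempty (fun a' => Q s' a')

/-- The optimality operator
`(H Q)(s,a) = ∑_{s'} T(s,a,s') [∑ᵢ rᵢ + f(r) max_{a'} Q(s', a')]`. -/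
noncomputable def bellman (M : MultiRewardMDP S A k) (f : (Fin (k + 1) → ℝ) → ℝ)
    (Q : S → A → ℝ) (s : S) (a : A) : ℝ :=
  ∑ s', M.trans s a s' * M.target f Q s a s'

/-- `Q` solves the Bellman optimality equation `Q = H Q`. -/
def IsOptimalQ (M : MultiRewardMDP S A k) (f : (Fin (k + 1) → ℝ) → ℝ)
    (Q : S → A → ℝ) : Prop :=
  ∀ s a, Q s a = M.bellman f Q s a

open Classical in
/-- The learning rate that is actually applied to the pair `(x, b)` at time `t`: it is
`α_t(x, b)` if `(x, b)` is the pair `(s_t, a_t)` visited at time `t`, and `0` otherwise. -/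
noncomputable def appliedRate {Ω : Type*} (s : ℕ → Ω → S) (a : ℕ → Ω → A)
    (α : ℕ → Ω → S → A → ℝ) (t : ℕ) (ω : Ω) (x : S) (b : A) : ℝ :=
  if s t ω = x ∧ a t ω = b then α t ω x b else 0

/-- The random tables `Q t` are the iterates of 1-step multi-discount Q-learning on `M`.
At time `t` the pair `(s t, a t)` is visited and the successor state `s' t` is observed; `ℱ t` is
the information available just before `s' t` is drawn. The case `s (t + 1) = s' t` is a single
trajectory; the general case allows restarts of episodes. The choice of `s t`, `a t` and of the
learning rates may depend on the past in any way. -/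
structure IsQLearning (M : MultiRewardMDP S A k) (f : (Fin (k + 1) → ℝ) → ℝ)
    [MeasurableSpace S] [MeasurableSpace A] {Ω : Type*} {mΩ : MeasurableSpace Ω}
    (μ : Measure Ω) (ℱ : Filtration ℕ mΩ)
    (s : ℕ → Ω → S) (a : ℕ → Ω → A) (s' : ℕ → Ω → S)
    (α : ℕ → Ω → S → A → ℝ) (Q : ℕ → Ω → S → A → ℝ) : Prop where
  measurable_state : ∀ t, Measurable[ℱ t] (s t)
  measurable_action : ∀ t, Measurable[ℱ t] (a t)
  measurable_rate : ∀ t, Measurable[ℱ t] (α t)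
  measurable_next : ∀ t, Measurable[ℱ (t + 1)] (s' t)
  measurable_init : Measurable[ℱ 0] (Q 0)
  /-- Given the past, `s' t` is distributed according to `T(s_t, a_t, ·)`. -/
  next_law : ∀ t y,
    μ[Set.indicator {ω | s' t ω = y} (fun _ => (1 : ℝ)) | ℱ t]
      =ᵐ[μ] fun ω => M.trans (s t ω) (a t ω) y
  /-- Only the entry of the visited pair is updated, because the applied rate of every other
  pair is zero. -/
  update : ∀ t ω x b, Q (t + 1) ω x b = Q t ω x b +
    appliedRate s a α t ω x b * (M.target f (Q t ω) x b (s' t ω) - Q t ω x b)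

end MultiRewardMDP

/-!
The Bellman operator is a contraction in the sup norm, so Banach's theorem gives the unique fixed
point `Q*`. For the convergence, let `Δ = Q t - Q*`. Splitting the sampled target at `Q*` instead
of at `Q t` turns the update into

  `Δ ← (1 - α) Δ + α (ξ + e)`,
  `ξ = target Q* - H Q*`, `e = target (Q t) - target Q*`.

The noise `ξ` depends on the table `Q*` only, so it is bounded by a constant and has conditional
mean zero, whatever the size of the arbitrary initial table. Since the discount is at most `γ'` for
every reward vector, the perturbation satisfies `|e| ≤ γ' * sup |Δ|` on every path
(`abs_target_sub_target_le`), not only in conditional expectation.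

* The series `∑ α ξ` converges almost surely (`ae_exists_tendsto_sum_of_summable_sq`): with the step
  sizes cut off once the sum of their squares exceeds a level, its partial sums are a martingale
  bounded in `L²`.
* The rest is deterministic (`tendsto_zero_of_contraction_add_noise`). As `∑ α ξ` converges and
  `∑ α` diverges, the recursion driven by `ξ` alone tends to zero. The remaining part of `Δ` averages
  `e`, so an eventual bound `D` on all entries of `|Δ|` improves to `(1 + γ') / 2 * D`, and iterating
  this gives `Δ → 0`.
-/

/-! ### Averaging recursions with step sizes of divergent sum -/

/-- The products `∏ (1 - α u)` tend to zero, since `1 - α ≤ exp (-α)` and `∑ α` diverges. -/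
theorem eventually_le_of_le_one_sub_mul {α y : ℕ → ℝ} (hα : ∀ t, α t ∈ Set.Icc (0 : ℝ) 1)
    (hsum : Tendsto (fun n => ∑ t ∈ Finset.range n, α t) atTop atTop) {N : ℕ}
    (hy : ∀ t, N ≤ t → y (t + 1) ≤ (1 - α t) * y t) {ε : ℝ} (hε : 0 < ε) :
    ∀ᶠ t in atTop, y t ≤ ε := by
  set P : ℕ → ℝ := fun n => ∑ t ∈ Finset.range n, α t with hP
  have key : ∀ n, N ≤ n → y n ≤ |y N| * Real.exp (P N - P n) := by
    intro n hn
    induction n, hn using Nat.le_induction with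
    | base => simpa using le_abs_self (y N)
    | succ n hn ih =>
      have h1 : 1 - α n ≤ Real.exp (-α n) := by
        have := Real.add_one_le_exp (-α n); linarith
      have h0 : 0 ≤ 1 - α n := by linarith [(hα n).2]
      calc y (n + 1) ≤ (1 - α n) * y n := hy n hn
        _ ≤ (1 - α n) * (|y N| * Real.exp (P N - P n)) := mul_le_mul_of_nonneg_left ih h0
        _ ≤ Real.exp (-α n) * (|y N| * Real.exp (P N - P n)) :=
            mul_le_mul_of_nonneg_right h1 (by positivity)
        _ = |y N| * Real.exp (P N - P (n + 1)) := by
            have : P N - P (n + 1) = -α n + (P N - P n) := by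
              simp only [hP, Finset.sum_range_succ]; ring
            rw [this, Real.exp_add]; ring
  have hlim : Tendsto (fun n => |y N| * Real.exp (P N - P n)) atTop (𝓝 0) := by
    have h : Tendsto (fun n => P N - P n) atTop atBot := by
      simpa [sub_eq_add_neg] using
        tendsto_atBot_add_const_left _ (P N) (tendsto_neg_atTop_atBot.comp hsum)
    simpa using (Real.tendsto_exp_atBot.comp h).const_mul |y N|
  filter_upwards [hlim.eventually (gt_mem_nhds hε), eventually_ge_atTop N] with n hn hN
  exact (key n hN).trans hn.le

/-- A weighted average of inputs that are eventually at most `c` in absolute value eventually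
forgets its initial value. -/
theorem eventually_abs_le_of_average {α y v : ℕ → ℝ} (hα : ∀ t, α t ∈ Set.Icc (0 : ℝ) 1)
    (hsum : Tendsto (fun n => ∑ t ∈ Finset.range n, α t) atTop atTop)
    (hy : ∀ t, y (t + 1) = (1 - α t) * y t + α t * v t) {c : ℝ}
    (hv : ∀ᶠ t in atTop, |v t| ≤ c) {ε : ℝ} (hε : 0 < ε) :
    ∀ᶠ t in atTop, |y t| ≤ c + ε := by
  obtain ⟨N, hN⟩ := eventually_atTop.1 hv
  have := eventually_le_of_le_one_sub_mul (y := fun t => |y t| - c) hα hsum (N := N) ?_ hε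
  · filter_upwards [this] with t ht
    linarith
  · intro t ht
    have h0 : 0 ≤ 1 - α t := by linarith [(hα t).2]
    have h : |y (t + 1)| ≤ (1 - α t) * |y t| + α t * |v t| := by
      rw [hy]
      refine (abs_add_le _ _).trans ?_
      rw [abs_mul, abs_mul, abs_of_nonneg h0, abs_of_nonneg (hα t).1]
    have h2 := mul_le_mul_of_nonneg_left (hN t ht) (hα t).1
    show |y (t + 1)| - c ≤ (1 - α t) * (|y t| - c)
    linarith

/-- If the series `∑ α t * ξ t` converges, then the average `w` of the noise `ξ` tends to zero:
after subtraction of the tail of the series, `w` averages a sequence that tends to zero. -/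
theorem tendsto_zero_of_tendsto_sum {α w ξ : ℕ → ℝ} (hα : ∀ t, α t ∈ Set.Icc (0 : ℝ) 1)
    (hsum : Tendsto (fun n => ∑ t ∈ Finset.range n, α t) atTop atTop)
    (hw : ∀ t, w (t + 1) = (1 - α t) * w t + α t * ξ t) {c : ℝ}
    (hc : Tendsto (fun n => ∑ t ∈ Finset.range n, α t * ξ t) atTop (𝓝 c)) :
    Tendsto w atTop (𝓝 0) := by
  set R : ℕ → ℝ := fun n => c - ∑ t ∈ Finset.range n, α t * ξ t with hR
  have hR0 : Tendsto R atTop (𝓝 0) := by simpa [hR] using hc.const_sub c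
  have hu : Tendsto (fun t => w t + R t) atTop (𝓝 0) := by
    rw [Metric.tendsto_atTop]
    intro ε hε
    have hv : ∀ᶠ t in atTop, |R t| ≤ ε / 4 := by
      have := (Metric.tendsto_nhds.1 hR0) (ε / 4) (by positivity)
      filter_upwards [this] with t ht
      simpa [Real.dist_eq] using ht.le
    have := eventually_abs_le_of_average (y := fun t => w t + R t) hα hsum
      (fun t => by simp only [hR, hw, Finset.sum_range_succ]; ring) hv
      (show 0 < ε / 4 by positivity)
    obtain ⟨N, hN⟩ := eventually_atTop.1 this
    refine ⟨N, fun n hn => ?_⟩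
    rw [Real.dist_eq, sub_zero]
    linarith [hN n hn]
  simpa using hu.sub hR0

/-- Asynchronous stochastic approximation along one path: the errors `Δ` average a noise `ξ`,
which averages out, and perturbations `e` that are smaller than the errors by a factor `γ < 1`. -/
theorem tendsto_zero_of_contraction_add_noise {ι : Type*} [Finite ι] {γ C : ℝ}
    (hγ0 : 0 ≤ γ) (hγ1 : γ < 1) {α Δ e ξ : ℕ → ι → ℝ}
    (hα : ∀ t i, α t i ∈ Set.Icc (0 : ℝ) 1)
    (hsum : ∀ i, Tendsto (fun n => ∑ t ∈ Finset.range n, α t i) atTop atTop)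
    (hΔ : ∀ t i, Δ (t + 1) i = (1 - α t i) * Δ t i + α t i * (ξ t i + e t i))
    (he : ∀ t i D, (∀ j, |Δ t j| ≤ D) → |e t i| ≤ γ * D)
    (hξ : ∀ t i, |ξ t i| ≤ C)
    (hc : ∀ i, ∃ c, Tendsto (fun n => ∑ t ∈ Finset.range n, α t i * ξ t i) atTop (𝓝 c)) (i : ι) :
    Tendsto (fun t => Δ t i) atTop (𝓝 0) := by
  have := Fintype.ofFinite ι
  -- The recursion started at zero and driven by the noise alone.
  let W : ι → ℕ → ℝ := fun i t => Nat.rec 0 (fun t w => (1 - α t i) * w + α t i * ξ t i) t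
  have hW : ∀ i, Tendsto (W i) atTop (𝓝 0) := fun i => by
    obtain ⟨c, hc⟩ := hc i
    exact tendsto_zero_of_tendsto_sum (α := fun t => α t i) (ξ := fun t => ξ t i)
      (fun t => hα t i) (hsum i) (fun t => rfl) hc
  have hγ : 0 < 1 - γ := by linarith
  -- `max D (C / (1 - γ))` is invariant, because `C + γ * D ≤ D` as soon as `C / (1 - γ) ≤ D`.
  obtain ⟨D, hD0, hD⟩ : ∃ D, 0 < D ∧ ∀ t i, |Δ t i| ≤ D := by
    have hC : 0 ≤ C := (abs_nonneg _).trans (hξ 0 i)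
    refine ⟨1 + ∑ j, |Δ 0 j| + C / (1 - γ), by positivity, fun t => ?_⟩
    set D := 1 + ∑ j, |Δ 0 j| + C / (1 - γ) with hD
    have hCD : C + γ * D ≤ D := by
      have h1 : C / (1 - γ) ≤ D := by
        have : 0 ≤ ∑ j, |Δ 0 j| := Finset.sum_nonneg fun j _ => abs_nonneg _
        linarith
      rw [div_le_iff₀ hγ] at h1
      linarith
    induction t with
    | zero =>
      intro j
      have h1 : |Δ 0 j| ≤ ∑ j, |Δ 0 j| :=
        Finset.single_le_sum (f := fun j => |Δ 0 j|) (fun j _ => abs_nonneg _) (Finset.mem_univ j)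
      have : 0 ≤ C / (1 - γ) := by positivity
      linarith
    | succ t ih =>
      intro j
      have h0 : 0 ≤ 1 - α t j := by linarith [(hα t j).2]
      have h1 : |ξ t j + e t j| ≤ D :=
        (abs_add_le _ _).trans ((add_le_add (hξ t j) (he t j D ih)).trans hCD)
      rw [hΔ]
      refine (abs_add_le _ _).trans ?_
      rw [abs_mul, abs_mul, abs_of_nonneg h0, abs_of_nonneg (hα t j).1]
      have h2 := mul_le_mul_of_nonneg_left (ih j) h0
      have h3 := mul_le_mul_of_nonneg_left h1 (hα t j).1
      linarith
  have step : ∀ D, 0 < D → (∀ᶠ t in atTop, ∀ i, |Δ t i| ≤ D) →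
      ∀ᶠ t in atTop, ∀ i, |Δ t i| ≤ (1 + γ) / 2 * D := by
    intro D hD hev
    rw [eventually_all]
    intro i
    have hδ : 0 < (1 - γ) / 4 * D := by positivity
    have hv : ∀ᶠ t in atTop, |e t i| ≤ γ * D := hev.mono fun t ht => he t i D ht
    have h1 := eventually_abs_le_of_average (y := fun t => Δ t i - W i t) (fun t => hα t i)
      (hsum i) (fun t => by
        show Δ (t + 1) i - ((1 - α t i) * W i t + α t i * ξ t i) = _
        rw [hΔ]; ring) hv hδ
    filter_upwards [h1, (Metric.tendsto_nhds.1 (hW i)) _ hδ] with t h1 h2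
    rw [Real.dist_eq, sub_zero] at h2
    have := abs_add_le (Δ t i - W i t) (W i t)
    rw [sub_add_cancel] at this
    linarith
  have iter : ∀ n : ℕ, ∀ᶠ t in atTop, ∀ i, |Δ t i| ≤ ((1 + γ) / 2) ^ n * D := by
    intro n
    induction n with
    | zero => exact Eventually.of_forall fun t i => by simpa using hD t i
    | succ n ih =>
      filter_upwards [step _ (by positivity) ih] with t ht i
      simpa [pow_succ', mul_assoc] using ht i
  rw [Metric.tendsto_nhds]
  intro ε hε
  have hlim : Tendsto (fun n : ℕ => ((1 + γ) / 2) ^ n * D) atTop (𝓝 0) := by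
    simpa using (tendsto_pow_atTop_nhds_zero_of_lt_one (r := (1 + γ) / 2) (by linarith)
      (by linarith)).mul_const D
  obtain ⟨n, hn⟩ := (hlim.eventually (gt_mem_nhds hε)).exists
  filter_upwards [iter n] with t ht
  rw [Real.dist_eq, sub_zero]
  exact (ht i).trans_lt hn

/-! ### Convergence of noise series -/

section Noise

variable {Ω : Type*} {mΩ : MeasurableSpace Ω} {μ : Measure Ω} [IsProbabilityMeasure μ]
  {ℱ : Filtration ℕ mΩ}

/-- The partial sums of bounded martingale differences form a martingale. They are orthogonal in
`L²`, so that a bound on the sum of their squares bounds the martingale in `L²`. -/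
theorem ae_exists_tendsto_sum_of_sum_sq_le {x : ℕ → Ω → ℝ} {C K : ℝ}
    (hx : ∀ t, StronglyMeasurable[ℱ (t + 1)] (x t)) (hC : ∀ t ω, |x t ω| ≤ C)
    (hx0 : ∀ t, μ[x t | ℱ t] =ᵐ[μ] 0)
    (hK : ∀ n ω, ∑ t ∈ Finset.range n, x t ω ^ 2 ≤ K) :
    ∀ᵐ ω ∂μ, ∃ c, Tendsto (fun n => ∑ t ∈ Finset.range n, x t ω) atTop (𝓝 c) := by
  set X : ℕ → Ω → ℝ := fun n ω => ∑ t ∈ Finset.range n, x t ω with hX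
  have hXm : StronglyAdapted ℱ X := fun n =>
    Finset.stronglyMeasurable_fun_sum _ fun t ht =>
      (hx t).mono (ℱ.mono (Nat.succ_le_of_lt (Finset.mem_range.1 ht)))
  have hXb : ∀ n ω, |X n ω| ≤ n * C := fun n ω => by
    refine (Finset.abs_sum_le_sum_abs _ _).trans ((Finset.sum_le_sum fun t _ => hC t ω).trans ?_)
    simp
  have int_of_bdd : ∀ {g : Ω → ℝ} {B : ℝ}, StronglyMeasurable[mΩ] g → (∀ ω, |g ω| ≤ B) →
      Integrable g μ := fun hg hB =>
    Integrable.of_bound hg.aestronglyMeasurable _ (Eventually.of_forall hB)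
  have hx' : ∀ t, StronglyMeasurable[mΩ] (x t) := fun t => (hx t).mono (ℱ.le _)
  have hX' : ∀ t, StronglyMeasurable[mΩ] (X t) := fun t => (hXm t).mono (ℱ.le _)
  have hxi : ∀ t, Integrable (x t) μ := fun t => int_of_bdd (hx' t) (hC t)
  have hXi : ∀ n, Integrable (X n) μ := fun n => int_of_bdd (hX' n) (hXb n)
  have hsq : ∀ {g : Ω → ℝ} {B : ℝ}, StronglyMeasurable[mΩ] g → (∀ ω, |g ω| ≤ B) →
      Integrable (fun ω => g ω ^ 2) μ := fun {g B} hg hB =>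
    int_of_bdd (hg.pow 2) (B := B ^ 2) fun ω => by
      show |g ω ^ 2| ≤ _
      rw [abs_pow]; exact pow_le_pow_left₀ (abs_nonneg _) (hB ω) 2
  have hXx : ∀ n, Integrable (X n * x n) μ := fun n =>
    int_of_bdd ((hX' n).mul (hx' n)) (B := n * C * C) fun ω => by
      rw [Pi.mul_apply, abs_mul]
      exact mul_le_mul (hXb n ω) (hC n ω) (abs_nonneg _) ((abs_nonneg _).trans (hXb n ω))
  have hmart : Martingale X ℱ μ := by
    refine martingale_of_condExp_sub_eq_zero_nat hXm hXi fun n => ?_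
    have : X (n + 1) - X n = x n := by
      ext ω; simp [hX, Finset.sum_range_succ]
    rw [this]; exact hx0 n
  have horth : ∀ n, ∫ ω, (X n * x n) ω ∂μ = 0 := fun n => by
    rw [← integral_condExp (ℱ.le n)]
    have h := (condExp_mul_of_stronglyMeasurable_left (hXm n) (hXx n) (hxi n)).trans
      ((EventuallyEq.refl _ (X n)).mul (hx0 n))
    rw [integral_congr_ae h]; simp
  have hL2 : ∀ n, ∫ ω, X n ω ^ 2 ∂μ = ∫ ω, ∑ t ∈ Finset.range n, x t ω ^ 2 ∂μ := by
    intro n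
    induction n with
    | zero => simp [hX]
    | succ n ih =>
      have h1 : ∀ ω, X (n + 1) ω ^ 2 = X n ω ^ 2 + (2 * (X n * x n) ω + x n ω ^ 2) := fun ω => by
        simp only [hX, Finset.sum_range_succ, Pi.mul_apply]; ring
      have hi : Integrable (fun ω => 2 * (X n * x n) ω + x n ω ^ 2) μ :=
        ((hXx n).const_mul 2).add (hsq (hx' n) (hC n))
      simp only [h1, Finset.sum_range_succ]
      rw [integral_add (hsq (hX' n) (hXb n)) hi,
        integral_add ((hXx n).const_mul 2) (hsq (hx' n) (hC n)), integral_const_mul, horth n,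
        integral_add (integrable_finsetSum _ fun t _ => hsq (hx' t) (hC t)) (hsq (hx' n) (hC n)),
        ih]
      ring
  refine hmart.submartingale.exists_ae_tendsto_of_bdd (R := (1 + K).toNNReal) fun n => ?_
  rw [eLpNorm_one_eq_lintegral_enorm, ← ofReal_integral_norm_eq_lintegral_enorm (hXi n)]
  refine ENNReal.ofReal_le_ofReal ?_
  have hb : ∫ ω, X n ω ^ 2 ∂μ ≤ K := by
    rw [hL2]
    refine (integral_mono (integrable_finsetSum _ fun t _ => hsq (hx' t) (hC t))
      (integrable_const K) (hK n)).trans ?_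
    simp
  calc ∫ ω, ‖X n ω‖ ∂μ ≤ ∫ ω, (1 + X n ω ^ 2) ∂μ :=
        integral_mono (hXi n).norm ((integrable_const 1).add (hsq (hX' n) (hXb n))) fun ω => by
          show |X n ω| ≤ 1 + X n ω ^ 2
          rw [← sq_abs]; nlinarith [sq_nonneg (|X n ω| - 1), abs_nonneg (X n ω)]
    _ = 1 + ∫ ω, X n ω ^ 2 ∂μ := by
        rw [integral_add (integrable_const 1) (hsq (hX' n) (hXb n))]; simp
    _ ≤ 1 + K := by linarith

/-- A series of squares that is stopped before it exceeds `K` stays below `K`. -/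
theorem sum_ite_sum_sq_le (b : ℕ → ℝ) {K : ℝ} (hK : 0 ≤ K) (n : ℕ) :
    ∑ t ∈ Finset.range n, (if ∑ u ∈ Finset.range (t + 1), b u ^ 2 ≤ K then b t ^ 2 else 0) ≤ K := by
  suffices h : ∑ t ∈ Finset.range n,
      (if ∑ u ∈ Finset.range (t + 1), b u ^ 2 ≤ K then b t ^ 2 else 0) ≤ K ∧
      ∑ t ∈ Finset.range n, (if ∑ u ∈ Finset.range (t + 1), b u ^ 2 ≤ K then b t ^ 2 else 0)
        ≤ ∑ t ∈ Finset.range n, b t ^ 2 from h.1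
  induction n with
  | zero => simpa using hK
  | succ n ih =>
    rw [Finset.sum_range_succ, Finset.sum_range_succ (fun t => b t ^ 2)]
    split_ifs with h
    · constructor <;> linarith [ih.2]
    · constructor <;> linarith [ih.1, ih.2, sq_nonneg (b n)]

/-- For predictable step sizes `β`, the noise series `∑ β t * ξ t` converges almost surely
wherever `∑ β t ^ 2` does. The sum of squares need not be integrable, so the steps are cut off
once the sum exceeds a level `K`; on a path with summable squares, a large `K` never acts. -/
theorem ae_exists_tendsto_sum_of_summable_sq {β ξ : ℕ → Ω → ℝ} {C : ℝ}
    (hβm : ∀ t, Measurable[ℱ t] (β t)) (hβ : ∀ t ω, β t ω ∈ Set.Icc (0 : ℝ) 1)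
    (hξm : ∀ t, Measurable[ℱ (t + 1)] (ξ t)) (hξ : ∀ t ω, |ξ t ω| ≤ C)
    (h0 : ∀ t, μ[fun ω => β t ω * ξ t ω | ℱ t] =ᵐ[μ] 0) :
    ∀ᵐ ω ∂μ, Summable (fun t => β t ω ^ 2) →
      ∃ c, Tendsto (fun n => ∑ t ∈ Finset.range n, β t ω * ξ t ω) atTop (𝓝 c) := by
  obtain ⟨E, hE_iff⟩ : ∃ E : ℕ → ℕ → Set Ω,
      ∀ K t ω, ω ∈ E K t ↔ ∑ u ∈ Finset.range (t + 1), β u ω ^ 2 ≤ K :=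
    ⟨fun K t => {ω | ∑ u ∈ Finset.range (t + 1), β u ω ^ 2 ≤ K}, fun _ _ _ => Iff.rfl⟩
  have hE : ∀ K t, MeasurableSet[ℱ t] (E K t) := fun K t => by
    have h : Measurable[ℱ t] fun ω => ∑ u ∈ Finset.range (t + 1), β u ω ^ 2 :=
      Finset.measurable_fun_sum _ fun u hu => Measurable.pow_const
        ((hβm u).mono (ℱ.mono (Nat.le_of_lt_succ (Finset.mem_range.1 hu))) le_rfl) 2
    have h' : E K t = (fun ω => ∑ u ∈ Finset.range (t + 1), β u ω ^ 2) ⁻¹' Set.Iic (K : ℝ) :=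
      Set.ext fun ω => hE_iff K t ω
    rw [h']
    exact h measurableSet_Iic
  have hprod : ∀ t, Measurable[ℱ (t + 1)] (fun ω => β t ω * ξ t ω) := fun t =>
    Measurable.mul ((hβm t).mono (ℱ.mono t.le_succ) le_rfl) (hξm t)
  have hbd : ∀ t ω, |β t ω * ξ t ω| ≤ C := fun t ω => by
    rw [abs_mul, abs_of_nonneg (hβ t ω).1]
    exact (mul_le_of_le_one_left (abs_nonneg _) (hβ t ω).2).trans (hξ t ω)
  have hK : ∀ K : ℕ, ∀ᵐ ω ∂μ, ∃ c, Tendsto (fun n => ∑ t ∈ Finset.range n,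
      (E K t).indicator (fun ω => β t ω * ξ t ω) ω) atTop (𝓝 c) := by
    intro K
    refine ae_exists_tendsto_sum_of_sum_sq_le (ℱ := ℱ) (C := C) (K := C ^ 2 * K) (fun t => ?_)
      (fun t ω => ?_) (fun t => ?_) (fun n ω => ?_)
    · exact ((hprod t).indicator (ℱ.mono t.le_succ _ (hE K t))).stronglyMeasurable
    · by_cases h : ω ∈ E K t
      · rw [Set.indicator_of_mem h]; exact hbd t ω
      · rw [Set.indicator_of_notMem h, abs_zero]; exact (abs_nonneg _).trans (hξ t ω)
    · have hint : Integrable (fun ω => β t ω * ξ t ω) μ :=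
        Integrable.of_bound ((hprod t).mono (ℱ.le _) le_rfl).aestronglyMeasurable C
          (Eventually.of_forall (hbd t))
      refine (condExp_indicator hint (hE K t)).trans ?_
      filter_upwards [h0 t] with ω hω
      by_cases h : ω ∈ E K t <;> simp [h, hω]
    · have h1 := sum_ite_sum_sq_le (fun t => β t ω) K.cast_nonneg n
      refine le_trans ?_ (mul_le_mul_of_nonneg_left h1 (sq_nonneg C))
      rw [Finset.mul_sum]
      refine Finset.sum_le_sum fun t _ => ?_
      by_cases h : ∑ u ∈ Finset.range (t + 1), β u ω ^ 2 ≤ K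
      · rw [Set.indicator_of_mem ((hE_iff K t ω).2 h), if_pos h, mul_pow, mul_comm]
        refine mul_le_mul_of_nonneg_right ?_ (sq_nonneg _)
        rw [← sq_abs]; exact pow_le_pow_left₀ (abs_nonneg _) (hξ t ω) 2
      · rw [Set.indicator_of_notMem (mt (hE_iff K t ω).1 h), if_neg h]; simp
  filter_upwards [ae_all_iff.2 hK] with ω hω hs
  obtain ⟨K, hsK⟩ := exists_nat_ge (∑' t, β t ω ^ 2)
  obtain ⟨c, hc⟩ := hω K
  have hmem : ∀ t, ω ∈ E K t := fun t =>
    (hE_iff K t ω).2 ((hs.sum_le_tsum _ fun u _ => sq_nonneg (β u ω)).trans hsK)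
  refine ⟨c, ?_⟩
  simpa only [Set.indicator_of_mem (hmem _)] using hc

end Noise

/-! ### The Bellman operator -/

namespace MultiRewardMDP

section Bellman

variable {S A : Type*} [Fintype S] [Fintype A] [Nonempty A] {k : ℕ}
  (M : MultiRewardMDP S A k) {f : (Fin (k + 1) → ℝ) → ℝ} {γ' : ℝ}

/-- For every single successor state, and not only on average, the sampled target is a contraction
in the table. -/
theorem abs_target_sub_target_le (hf : ∀ r, f r ∈ Set.Icc (0 : ℝ) 1) (hfγ' : ∀ r, f r ≤ γ')
    {Q Q' : S → A → ℝ} {D : ℝ} (h : ∀ x b, |Q x b - Q' x b| ≤ D) (x : S) (b : A) (y : S) :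
    |M.target f Q x b y - M.target f Q' x b y| ≤ γ' * D := by
  have sup_le : ∀ {q q' : A → ℝ}, (∀ c, |q c - q' c| ≤ D) →
      Finset.univ.sup' Finset.univ_nonempty q ≤ Finset.univ.sup' Finset.univ_nonempty q' + D := by
    intro q q' hq
    refine Finset.sup'_le _ _ fun c hc => ?_
    have h1 := (abs_le.1 (hq c)).2
    have h2 := Finset.le_sup' q' hc
    linarith
  have hsup : |Finset.univ.sup' Finset.univ_nonempty (fun c => Q y c) -
      Finset.univ.sup' Finset.univ_nonempty (fun c => Q' y c)| ≤ D := by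
    have h1 := sup_le (h y)
    have h2 := sup_le (q := Q' y) (q' := Q y) fun c => by rw [abs_sub_comm]; exact h y c
    rw [abs_le]
    constructor <;> linarith
  have heq : M.target f Q x b y - M.target f Q' x b y = f (M.reward x b y) *
      (Finset.univ.sup' Finset.univ_nonempty (fun c => Q y c) -
        Finset.univ.sup' Finset.univ_nonempty (fun c => Q' y c)) := by
    simp only [target]; ring
  rw [heq, abs_mul, abs_of_nonneg (hf _).1]
  exact mul_le_mul (hfγ' _) hsup (abs_nonneg _) ((hf (M.reward x b y)).1.trans (hfγ' _))

theorem abs_bellman_sub_bellman_le (hf : ∀ r, f r ∈ Set.Icc (0 : ℝ) 1) (hfγ' : ∀ r, f r ≤ γ')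
    {Q Q' : S → A → ℝ} {D : ℝ} (h : ∀ x b, |Q x b - Q' x b| ≤ D) (x : S) (b : A) :
    |M.bellman f Q x b - M.bellman f Q' x b| ≤ γ' * D := by
  simp only [bellman, ← Finset.sum_sub_distrib, ← mul_sub]
  calc _ ≤ ∑ y, M.trans x b y * (γ' * D) := by
        refine (Finset.abs_sum_le_sum_abs _ _).trans (Finset.sum_le_sum fun y _ => ?_)
        rw [abs_mul, abs_of_nonneg (M.trans_nonneg x b y)]
        exact mul_le_mul_of_nonneg_left (M.abs_target_sub_target_le hf hfγ' h x b y)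
          (M.trans_nonneg x b y)
    _ = γ' * D := by rw [← Finset.sum_mul, M.trans_sum, one_mul]

theorem existsUnique_isOptimalQ (hf : ∀ r, f r ∈ Set.Icc (0 : ℝ) 1) (hγ' : γ' < 1)
    (hfγ' : ∀ r, f r ≤ γ') : ∃! Qstar : S → A → ℝ, M.IsOptimalQ f Qstar := by
  have h0 : 0 ≤ γ' := (hf 0).1.trans (hfγ' 0)
  have hlip : ContractingWith ⟨γ', h0⟩ (M.bellman f) := by
    refine ⟨by exact_mod_cast hγ', LipschitzWith.of_dist_le_mul fun Q Q' => ?_⟩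
    have hD : ∀ x b, |Q x b - Q' x b| ≤ dist Q Q' := fun x b =>
      (dist_le_pi_dist (Q x) (Q' x) b).trans (dist_le_pi_dist Q Q' x)
    have hpos : (0 : ℝ) ≤ γ' * dist Q Q' := by positivity
    exact (dist_pi_le_iff hpos).2 fun x => (dist_pi_le_iff hpos).2 fun b =>
      M.abs_bellman_sub_bellman_le hf hfγ' hD x b
  refine ⟨ContractingWith.fixedPoint _ hlip, fun x b => ?_, fun Q hQ => ?_⟩
  · exact (congrFun (congrFun hlip.fixedPoint_isFixedPt x) b).symm
  · exact hlip.fixedPoint_unique (funext fun x => funext fun b => (hQ x b).symm)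

end Bellman

/-! ### The sampling noise of Q-learning -/

section QLearning

theorem appliedRate_mem_Icc {S A Ω : Type*} {s : ℕ → Ω → S} {a : ℕ → Ω → A}
    {α : ℕ → Ω → S → A → ℝ} (hα : ∀ t ω x b, α t ω x b ∈ Set.Icc (0 : ℝ) 1)
    (t : ℕ) (ω : Ω) (x : S) (b : A) : appliedRate s a α t ω x b ∈ Set.Icc (0 : ℝ) 1 := by
  unfold appliedRate
  split_ifs
  · exact hα t ω x b
  · simp

variable {S A : Type*} [Fintype S] [Fintype A] [Nonempty A]
  [MeasurableSpace S] [MeasurableSingletonClass S]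
  [MeasurableSpace A] [MeasurableSingletonClass A] {k : ℕ}
  {M : MultiRewardMDP S A k} {f : (Fin (k + 1) → ℝ) → ℝ}
  {Ω : Type*} {mΩ : MeasurableSpace Ω} {μ : Measure Ω}
  {ℱ : Filtration ℕ mΩ} {s : ℕ → Ω → S} {a : ℕ → Ω → A} {s' : ℕ → Ω → S}
  {α : ℕ → Ω → S → A → ℝ} {Q : ℕ → Ω → S → A → ℝ}

theorem IsQLearning.measurable_appliedRate (hQ : M.IsQLearning f μ ℱ s a s' α Q)
    (t : ℕ) (x : S) (b : A) : Measurable[ℱ t] fun ω => appliedRate s a α t ω x b := by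
  have h1 : MeasurableSet[ℱ t] {ω | s t ω = x ∧ a t ω = b} :=
    (hQ.measurable_state t (measurableSet_singleton x)).inter
      (hQ.measurable_action t (measurableSet_singleton b))
  have h2 : Measurable[ℱ t] fun ω => α t ω x b :=
    (measurable_pi_apply b).comp ((measurable_pi_apply x).comp (hQ.measurable_rate t))
  exact Measurable.ite h1 h2 measurable_const

variable [IsProbabilityMeasure μ]

/-- For a fixed function `g` of the successor state, the deviation of `g (s' t)` from its mean
under the law `trans x b` has conditional mean zero at the times when `(x, b)` is visited. -/
theorem IsQLearning.condExp_appliedRate_mul_noise (hQ : M.IsQLearning f μ ℱ s a s' α Q)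
    (hα : ∀ t ω x b, α t ω x b ∈ Set.Icc (0 : ℝ) 1) (g : S → ℝ) (t : ℕ) (x : S) (b : A) :
    μ[fun ω => appliedRate s a α t ω x b * (g (s' t ω) - ∑ y, M.trans x b y * g y) | ℱ t]
      =ᵐ[μ] 0 := by
  classical
  set β : Ω → ℝ := fun ω => appliedRate s a α t ω x b with hβ
  set m : ℝ := ∑ y, M.trans x b y * g y with hm
  have hβm : StronglyMeasurable[ℱ t] β := (hQ.measurable_appliedRate t x b).stronglyMeasurable
  have hβ1 := appliedRate_mem_Icc (s := s) (a := a) hα t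
  let I : S → Ω → ℝ := fun y => Set.indicator {ω | s' t ω = y} fun _ => (1 : ℝ)
  have hIm : ∀ y, MeasurableSet {ω | s' t ω = y} := fun y =>
    ℱ.le (t + 1) _ (hQ.measurable_next t (measurableSet_singleton y))
  have hI : ∀ y, Integrable (I y) μ := fun y => (integrable_const 1).indicator (hIm y)
  have hbdd : ∀ {h : Ω → ℝ}, Integrable h μ → Integrable (β * h) μ := fun hh =>
    hh.bdd_mul (hβm.mono (ℱ.le t)).aestronglyMeasurable (c := 1) (Eventually.of_forall fun ω => by
      rw [Real.norm_eq_abs, abs_of_nonneg (hβ1 ω x b).1]; exact (hβ1 ω x b).2)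
  have hdec : (fun ω => g (s' t ω) - m) = ∑ y, (g y - m) • I y := by
    ext ω
    simp [I, Finset.sum_apply, Set.indicator_apply]
  have hint : Integrable (fun ω => g (s' t ω) - m) μ := by
    rw [hdec]; exact integrable_finsetSum' _ fun y _ => (hI y).smul _
  have h1 := condExp_mul_of_stronglyMeasurable_left hβm (hbdd hint) hint
  have h2 : μ[fun ω => g (s' t ω) - m | ℱ t] =ᵐ[μ]
      fun ω => ∑ y, (g y - m) * M.trans (s t ω) (a t ω) y := by
    rw [hdec]
    refine (condExp_finsetSum (fun y _ => (hI y).smul (g y - m)) _).trans ?_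
    have h3 : ∀ y, μ[(g y - m) • I y | ℱ t] =ᵐ[μ]
        fun ω => (g y - m) * M.trans (s t ω) (a t ω) y := fun y => by
      filter_upwards [condExp_smul (μ := μ) (g y - m) (I y) (ℱ t), hQ.next_law t y] with ω h4 h5
      rw [h4, Pi.smul_apply, smul_eq_mul, h5]
    filter_upwards [ae_all_iff.2 h3] with ω hω
    simp [Finset.sum_apply, hω]
  refine EventuallyEq.trans h1 ?_
  filter_upwards [h2] with ω hω
  rw [Pi.mul_apply, hω, Pi.zero_apply]
  by_cases hv : s t ω = x ∧ a t ω = b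
  · obtain ⟨rfl, rfl⟩ := hv
    have : ∑ y, (g y - m) * M.trans (s t ω) (a t ω) y = 0 := by
      simp only [sub_mul, Finset.sum_sub_distrib, ← Finset.mul_sum, M.trans_sum, hm]
      simp [mul_comm]
    rw [this, mul_zero]
  · simp [hβ, appliedRate, hv]

/-- The noise series of a fixed pair converges almost surely. -/
theorem IsQLearning.ae_exists_tendsto_sum_noise (hQ : M.IsQLearning f μ ℱ s a s' α Q)
    (hα : ∀ t ω x b, α t ω x b ∈ Set.Icc (0 : ℝ) 1) (g : S → ℝ) (x : S) (b : A)
    (hα_sq : ∀ᵐ ω ∂μ, Summable (fun t => appliedRate s a α t ω x b ^ 2)) :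
    ∀ᵐ ω ∂μ, ∃ c, Tendsto (fun n => ∑ t ∈ Finset.range n,
      appliedRate s a α t ω x b * (g (s' t ω) - ∑ y, M.trans x b y * g y)) atTop (𝓝 c) := by
  have h := ae_exists_tendsto_sum_of_summable_sq (μ := μ) (ℱ := ℱ)
    (β := fun t ω => appliedRate s a α t ω x b)
    (ξ := fun t ω => g (s' t ω) - ∑ y, M.trans x b y * g y)
    (C := ∑ z, |g z - ∑ y, M.trans x b y * g y|)
    (fun t => hQ.measurable_appliedRate t x b) (fun t ω => appliedRate_mem_Icc hα t ω x b)
    (fun t => ((measurable_of_countable g).comp (hQ.measurable_next t)).sub_const _)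
    (fun t ω => Finset.single_le_sum (f := fun z => |g z - ∑ y, M.trans x b y * g y|)
      (fun z _ => abs_nonneg _) (Finset.mem_univ (s' t ω)))
    (fun t => hQ.condExp_appliedRate_mul_noise hα g t x b)
  filter_upwards [h, hα_sq] with ω h1 h2 using h1 h2

end QLearning

end MultiRewardMDP

theorem mainTheorem1 {S A : Type*} [Fintype S] [Fintype A] [Nonempty A]
    [MeasurableSpace S] [MeasurableSingletonClass S]
    [MeasurableSpace A] [MeasurableSingletonClass A] {k : ℕ}
    (M : MultiRewardMDP S A k)
    (f : (Fin (k + 1) → ℝ) → ℝ) (hf : ∀ r, f r ∈ Set.Icc (0 : ℝ) 1)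
    (γ' : ℝ) (hγ' : γ' < 1) (hfγ' : ∀ r, f r ≤ γ')
    {Ω : Type*} {mΩ : MeasurableSpace Ω} (μ : Measure Ω) [IsProbabilityMeasure μ]
    (ℱ : Filtration ℕ mΩ)
    (s : ℕ → Ω → S) (a : ℕ → Ω → A) (s' : ℕ → Ω → S)
    (α : ℕ → Ω → S → A → ℝ) (Q : ℕ → Ω → S → A → ℝ)
    (hQ : M.IsQLearning f μ ℱ s a s' α Q)
    (hα : ∀ t ω x b, α t ω x b ∈ Set.Icc (0 : ℝ) 1)
    (hα_sum : ∀ x b, ∀ᵐ ω ∂μ, Tendsto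
      (fun n => ∑ t ∈ Finset.range n, MultiRewardMDP.appliedRate s a α t ω x b) atTop atTop)
    (hα_sq : ∀ x b, ∀ᵐ ω ∂μ,
      Summable (fun t => MultiRewardMDP.appliedRate s a α t ω x b ^ 2)) :
    (∃! Qstar : S → A → ℝ, M.IsOptimalQ f Qstar) ∧
    ∀ Qstar : S → A → ℝ, M.IsOptimalQ f Qstar →
      ∀ᵐ ω ∂μ, ∀ x b, Tendsto (fun t => Q t ω x b) atTop (𝓝 (Qstar x b)) := by
  refine ⟨M.existsUnique_isOptimalQ hf hγ' hfγ', fun Qstar hQstar => ?_⟩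
  have hnoise : ∀ᵐ ω ∂μ, ∀ x b, ∃ c, Tendsto (fun n => ∑ t ∈ Finset.range n,
      MultiRewardMDP.appliedRate s a α t ω x b *
        (M.target f Qstar x b (s' t ω) - M.bellman f Qstar x b)) atTop (𝓝 c) :=
    ae_all_iff.2 fun x => ae_all_iff.2 fun b =>
      hQ.ae_exists_tendsto_sum_noise hα (M.target f Qstar x b) x b (hα_sq x b)
  filter_upwards [hnoise, ae_all_iff.2 fun x => ae_all_iff.2 fun b => hα_sum x b] with ω hω hs x b
  have h := tendsto_zero_of_contraction_add_noise (ι := S × A) (γ := γ')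
    (C := ∑ i : S × A, ∑ y, |M.target f Qstar i.1 i.2 y - M.bellman f Qstar i.1 i.2|)
    ((hf 0).1.trans (hfγ' 0)) hγ'
    (α := fun t i => MultiRewardMDP.appliedRate s a α t ω i.1 i.2)
    (Δ := fun t i => Q t ω i.1 i.2 - Qstar i.1 i.2)
    (e := fun t i => M.target f (Q t ω) i.1 i.2 (s' t ω) - M.target f Qstar i.1 i.2 (s' t ω))
    (ξ := fun t i => M.target f Qstar i.1 i.2 (s' t ω) - M.bellman f Qstar i.1 i.2)
    (fun t i => MultiRewardMDP.appliedRate_mem_Icc hα t ω i.1 i.2) (fun i => hs i.1 i.2)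
    (fun t i => by
      rw [hQ.update]
      linear_combination (-MultiRewardMDP.appliedRate s a α t ω i.1 i.2) * hQstar i.1 i.2)
    (fun t i D hD => M.abs_target_sub_target_le hf hfγ' (fun x b => hD (x, b)) i.1 i.2 (s' t ω))
    (fun t i => (Finset.single_le_sum
        (f := fun y => |M.target f Qstar i.1 i.2 y - M.bellman f Qstar i.1 i.2|)
        (fun y _ => abs_nonneg _) (Finset.mem_univ (s' t ω))).trans
      (Finset.single_le_sum
        (f := fun i : S × A => ∑ y, |M.target f Qstar i.1 i.2 y - M.bellman f Qstar i.1 i.2|)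
        (fun i _ => Finset.sum_nonneg fun y _ => abs_nonneg _) (Finset.mem_univ i)))
    (fun i => hω i.1 i.2) (x, b)
  simpa using h.add_const (Qstar x b)
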